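/- Let $V$ be a finite-dimensional real vector space, $V^+\subset V$ a proper (closed, pointed in the sense $V^+\cap(-V^+)=\{0\}$, and generating) convex cone, $A=V^*$, $A^+=(V^+)^*$ the dual cone, and $\mathbb 1\in A^+$ an order unit; the triple $(V,V^+,\mathbb 1)$ is a general probabilistic theory (GPT). Suppose it is centrally symmetric: there are a decomposition $V=\mathbb R v_0\oplus\bar V$ and a norm $\|\cdot\|_{\bar V}$ on $\bar V$ such that, writing $x=x_0v_0+\bar x$, one has $x\in V^+\iff\|\bar x\|_{\bar V}\le x_0$, and $\mathbb 1(x)=x_0$. Let $\bar A=\bar V^*$ with the dual norm. For $g\in\mathbb N$, a dichotomic measurement is a pair $f=(f_1,f_2)$ in $A^+$ with $f_1+f_2=\mathbb 1$. A $g$-tuple of dichotomic measurements $(f^{(1)},\dots,f^{(g)})$ is compatible if there are $h_m\in A^+$, $m\in\{1,2\}^g$, with $\sum_m h_m=\mathbb 1$ and $f^{(i)}_j=\sum_{m:\,m_i=j}h_m$ for all $i,j$. Let $\Gamma(g;V,V^+)$ be the set of $s\in[0,1]^g$ such that for all $g$-tuples $f$ of dichotomic measurements the measurements $s_if^{(i)}+(1-s_i)(\mathbb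 1/2,\mathbb 1/2)$, $i=1,\dots,g$, are compatible, and let $\gamma(g;V,V^+)=\max\{s\in[0,1]:(s,\dots,s)\in\Gamma(g;V,V^+)\}$. For normed spaces $X,Y$ and $z\in X\otimes Y$ put $$\|z\|_{X\otimes_\pi Y}=\inf\Big\{\sum_k\|x_k\|\|y_k\| : z=\sum_k x_k\otimes y_k\Big\},\qquad \|z\|_{X\otimes_\epsilon Y}=\sup\{|(\phi\otimes\psi)(z)| : \|\phi\|_{X^*}\le1,\ \|\psi\|_{Y^*}\le1\}.$$ For $s\in\mathbb R^g$ and $z=\sum_{i=1}^g e_i\otimes z_i\in\mathbb R^g\otimes Y$ put $s.z=\sum_i e_i\otimes s_iz_i$. Theorem. For every $g$, $$\Gamma(g;V,V^+)=\{s\in[0,1]^g:\ \|s.\bar z\|_{\ell_1^g\otimes_\pi\bar V}\le1\ \text{ for all }\bar z\in\ell_1^g\otimes\bar V\text{ with }\|\bar z\|_{\ell_1^g\otimes_\epsilon\bar V}\le1\}$$ $$=\{s\in[0,1]^g:\ \|s.\bar\phi\|_{\ell_\infty^g\otimes_\pi\bar A}\le1\ \text{ for all }\bar\phi\in\ell_\infty^g\otimes\bar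 A\text{ with }\|\bar\phi\|_{\ell_\infty^g\otimes_\epsilon\bar A}\le1\},$$ and the maximum defining $\gamma(g;V,V^+)$ is attained. If moreover $g\ge1$ and $\bar V\ne0$, then for $(X,Y)=(\ell_\infty^g,\bar A)$ and for $(X,Y)=(\ell_1^g,\bar V)$ the maxima in $$\rho(X,Y)=\max_{0\neq z\in X\otimes Y}\frac{\|z\|_{X\otimes_\pi Y}}{\|z\|_{X\otimes_\epsilon Y}}=\max_{\|z\|_{X\otimes_\epsilon Y}\le1}\|z\|_{X\otimes_\pi Y}$$ are attained and equal, and $$\gamma(g;V,V^+)=\frac1{\rho(\ell_\infty^g,\bar A)}=\frac1{\rho(\ell_1^g,\bar V)}.$$ -/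

import Mathlib

open scoped TensorProduct ENNReal

noncomputable section

/-! ### General probabilistic theories -/

/-- A general probabilistic theory `(V, V⁺, 𝟙)`: a proper (closed, salient, generating) convex cone
`V⁺` in `V`, with an order unit `𝟙` of the dual cone `A⁺ = (V⁺)* ⊆ A = V*`. It is used for
finite-dimensional `V`, with the unique Hausdorff vector space topology. -/
structure GPT (V : Type*) [AddCommGroup V] [Module ℝ V] [TopologicalSpace V] where
  /-- The cone `V⁺` of unnormalized states. -/
  cone : PointedCone ℝ V
  isClosed_cone : IsClosed (cone : Set V)
  salient : ∀ x ∈ cone, -x ∈ cone → x = 0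
  generating : ∀ x : V, ∃ y ∈ cone, ∃ z ∈ cone, x = y - z
  /-- The order unit `𝟙`. -/
  unit : Module.Dual ℝ V
  unit_mem : unit ∈ PointedCone.dual (Module.Dual.eval ℝ V) (cone : Set V)
  unit_orderUnit : ∀ f : Module.Dual ℝ V, ∃ t : ℝ, 0 < t ∧
    t • unit - f ∈ PointedCone.dual (Module.Dual.eval ℝ V) (cone : Set V) ∧
    t • unit + f ∈ PointedCone.dual (Module.Dual.eval ℝ V) (cone : Set V)

namespace GPT

variable {V : Type*} [AddCommGroup V] [Module ℝ V] [TopologicalSpace V]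

/-- The dual cone `A⁺ = (V⁺)*`. -/
def dualCone (G : GPT V) : PointedCone ℝ (Module.Dual ℝ V) :=
  PointedCone.dual (Module.Dual.eval ℝ V) (G.cone : Set V)

/-- A decomposition `V ≅ ℝ ⊕ W` exhibiting the GPT as centrally symmetric, where the normed space
`W` is `V̄`: writing `x = (x₀, x̄)`, one has `x ∈ V⁺ ↔ ‖x̄‖ ≤ x₀` and `𝟙 x = x₀`. The distinguished
vector `v₀` is `toProd.symm (1, 0)`. -/
structure CentralSymmetry (G : GPT V) (W : Type*) [NormedAddCommGroup W] [NormedSpace ℝ W] where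
  toProd : V ≃ₗ[ℝ] ℝ × W
  mem_cone_iff : ∀ x : V, x ∈ G.cone ↔ ‖(toProd x).2‖ ≤ (toProd x).1
  unit_apply : ∀ x : V, G.unit x = (toProd x).1

/-- A measurement with finite outcome set `ι`: a tuple of elements of `A⁺` with sum `𝟙`. -/
def IsMeasurement (G : GPT V) {ι : Type*} [Fintype ι] (f : ι → Module.Dual ℝ V) : Prop :=
  (∀ j, f j ∈ G.dualCone) ∧ ∑ j, f j = G.unit

/-- A collection of `g` measurements, the `i`-th having `k i` outcomes, is compatible if all of
them are marginals of a joint measurement with outcomes in `[k₁] × ⋯ × [k_g]`. -/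
def Compatible (G : GPT V) {g : ℕ} {k : Fin g → ℕ} (f : ∀ i, Fin (k i) → Module.Dual ℝ V) : Prop :=
  ∃ h : (∀ i, Fin (k i)) → Module.Dual ℝ V, G.IsMeasurement h ∧
    ∀ (i : Fin g) (j : Fin (k i)),
      f i j = ∑ m ∈ Finset.univ.filter (fun m : ∀ i, Fin (k i) => m i = j), h m

/-- The measurements `sᵢ f⁽ⁱ⁾ + (1 - sᵢ) 𝟙 / kᵢ` with white noise. -/
def noisy (G : GPT V) {g : ℕ} {k : Fin g → ℕ} (s : Fin g → ℝ)
    (f : ∀ i, Fin (k i) → Module.Dual ℝ V) : ∀ i, Fin (k i) → Module.Dual ℝ V :=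
  fun i j => s i • f i j + ((1 - s i) / (k i : ℝ)) • G.unit

/-- The compatibility region `Γ(k; V, V⁺) ⊆ [0,1]^g`. -/
def compatibilityRegion (G : GPT V) {g : ℕ} (k : Fin g → ℕ) : Set (Fin g → ℝ) :=
  {s | (∀ i, s i ∈ Set.Icc (0 : ℝ) 1) ∧
    ∀ f : ∀ i, Fin (k i) → Module.Dual ℝ V, (∀ i, G.IsMeasurement (f i)) →
      G.Compatible (G.noisy s f)}

/-- The set of `s ∈ [0,1]` with `(s, …, s) ∈ Γ(k; V, V⁺)`. -/
def diagonalRegion (G : GPT V) {g : ℕ} (k : Fin g → ℕ) : Set ℝ :=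
  {s | s ∈ Set.Icc (0 : ℝ) 1 ∧ (fun _ => s) ∈ G.compatibilityRegion k}

/-- The compatibility degree `γ(k; V, V⁺)`, the largest element of `diagonalRegion`. -/
def compatibilityDegree (G : GPT V) {g : ℕ} (k : Fin g → ℕ) : ℝ :=
  sSup (G.diagonalRegion k)

/-- The outcome numbers `(2, …, 2)` of `g` dichotomic measurements. -/
abbrev dichotomic (g : ℕ) : Fin g → ℕ := fun _ => 2

end GPT

/-! ### Tensor norms -/

section TensorNorms

variable {X Y : Type*} [NormedAddCommGroup X] [NormedSpace ℝ X]
  [NormedAddCommGroup Y] [NormedSpace ℝ Y]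

/-- The projective norm on `X ⊗ Y`. -/
def projectiveNorm (z : X ⊗[ℝ] Y) : ℝ :=
  sInf {r | ∃ (n : ℕ) (x : Fin n → X) (y : Fin n → Y),
    z = ∑ i, x i ⊗ₜ[ℝ] y i ∧ r = ∑ i, ‖x i‖ * ‖y i‖}

/-- The injective norm on `X ⊗ Y`. -/
def injectiveNorm (z : X ⊗[ℝ] Y) : ℝ :=
  sSup {r | ∃ (φ : StrongDual ℝ X) (ψ : StrongDual ℝ Y), ‖φ‖ ≤ 1 ∧ ‖ψ‖ ≤ 1 ∧
    r = |TensorProduct.dualDistrib ℝ X Y ((φ : X →ₗ[ℝ] ℝ) ⊗ₜ[ℝ] (ψ : Y →ₗ[ℝ] ℝ)) z|}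

variable (X Y)

/-- The ratios `‖z‖_π / ‖z‖_ε` of nonzero `z ∈ X ⊗ Y`. -/
def normRatios : Set ℝ :=
  {r | ∃ z : X ⊗[ℝ] Y, z ≠ 0 ∧ r = projectiveNorm z / injectiveNorm z}

/-- The maximal ratio `ρ(X, Y)` between the projective and the injective norm. -/
def maxNormRatio : ℝ := sSup (normRatios X Y)

end TensorNorms

/-- The space `ℓ_p^g`. -/
abbrev ell (p : ℝ≥0∞) (g : ℕ) : Type := PiLp p (fun _ : Fin g => ℝ)

/-- The diagonal map `(xᵢ) ↦ (sᵢ xᵢ)` on `ℓ_p^g`. -/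
def diagonalMap (p : ℝ≥0∞) {g : ℕ} (s : Fin g → ℝ) : ell p g →ₗ[ℝ] ell p g where
  toFun x := WithLp.toLp p (fun i => s i * x i)
  map_add' x y := by ext i; simp [mul_add]
  map_smul' c x := by ext i; simp [mul_left_comm]

/-- The scaling `s.z` of `z ∈ ℓ_p^g ⊗ Y`, which sends `∑ᵢ eᵢ ⊗ zᵢ` to `∑ᵢ eᵢ ⊗ sᵢ zᵢ`. -/
def tensorScale (p : ℝ≥0∞) {g : ℕ} {Y : Type*} [AddCommGroup Y] [Module ℝ Y] (s : Fin g → ℝ) :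
    ell p g ⊗[ℝ] Y →ₗ[ℝ] ell p g ⊗[ℝ] Y :=
  LinearMap.rTensor Y (diagonalMap p s)

theorem tensorScale_sum_single (p : ℝ≥0∞) {g : ℕ} {Y : Type*} [AddCommGroup Y] [Module ℝ Y]
    (s : Fin g → ℝ) (z : Fin g → Y) :
    tensorScale p s (∑ i, (WithLp.toLp p (Pi.single i (1 : ℝ)) : ell p g) ⊗ₜ[ℝ] z i) =
      ∑ i, (WithLp.toLp p (Pi.single i (1 : ℝ)) : ell p g) ⊗ₜ[ℝ] (s i • z i) := by
  rw [map_sum]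
  refine Finset.sum_congr rfl fun i _ => ?_
  have h : diagonalMap p s (WithLp.toLp p (Pi.single i (1 : ℝ))) =
      s i • (WithLp.toLp p (Pi.single i (1 : ℝ)) : ell p g) := by
    ext j
    by_cases hj : j = i
    · subst hj; simp [diagonalMap]
    · simp [diagonalMap, hj]
  simp only [tensorScale, LinearMap.rTensor_tmul]
  rw [h, TensorProduct.smul_tmul]

/-- The set of `s ∈ [0,1]^g` that scale the unit ball of `ℓ_p^g ⊗_ε Y` into the unit ball of
`ℓ_p^g ⊗_π Y`. -/
def scalingRegion (p : ℝ≥0∞) [Fact (1 ≤ p)] (g : ℕ) (Y : Type*) [NormedAddCommGroup Y]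
    [NormedSpace ℝ Y] : Set (Fin g → ℝ) :=
  {s | (∀ i, s i ∈ Set.Icc (0 : ℝ) 1) ∧
    ∀ z : ell p g ⊗[ℝ] Y, injectiveNorm z ≤ 1 → projectiveNorm (tensorScale p s z) ≤ 1}

end

/-! The regions coincide by a cycle of three inclusions: compatibility region into the `ℓ_∞ ⊗ Ā`
scaling region, into the `ℓ_1 ⊗ V̄` one, and back. Three of the four norms are explicit. For `∑ eᵢ ⊗
zᵢ`, the projective norm over `ℓ_1` is `∑ ‖zᵢ‖`, the injective norm over `ℓ_1` is the maximum of `‖∑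
±zᵢ‖` over signs, and the injective norm over `ℓ_∞` is `max ‖zᵢ‖`.

An effect is a pair `(a, ψ)` with `‖ψ‖ ≤ a`. The unbiased measurements `(1/2, ±φᵢ/2)` are thus
indexed by the injective unit ball over `ℓ_∞`, and a joint measurement `hₘ` of their noisy versions
has vector parts `ψₘ` with `sᵢ φᵢ = ∑ₘ ±ψₘ` and `∑ ‖ψₘ‖ ≤ 1`. This writes `s.φ` as a sum of sign
vectors tensor `ψₘ` and bounds its projective norm (`compatibilityRegion_subset_scalingRegion`).
Pairing with norming functionals passes to `ℓ_1 ⊗ V̄`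
(`scalingRegion_top_dual_subset_scalingRegion_one`). Hahn–Banach recovers such `ψₘ` from the `ℓ_1`
bound (`exists_sign_decomposition`), symmetrization turns them into a joint measurement
(`compatible_of_sign_decomposition`), and biased measurements are post-processings of unbiased ones
(`scalingRegion_subset_compatibilityRegion`).

On the diagonal, `s.z` is a scalar multiple of `z`, so the degree is the reciprocal of the largest
norm ratio, attained by compactness. -/

/-! ### Projective and injective norms on finite-dimensional tensor products -/

section TensorNorms

variable {X Y : Type*} [NormedAddCommGroup X] [NormedSpace ℝ X]
  [NormedAddCommGroup Y] [NormedSpace ℝ Y]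

/-- The functional `φ ⊗ ψ` on `X ⊗ Y`. -/
noncomputable def tensorPairing (φ : StrongDual ℝ X) (ψ : StrongDual ℝ Y) : X ⊗[ℝ] Y →ₗ[ℝ] ℝ :=
  TensorProduct.dualDistrib ℝ X Y ((φ : X →ₗ[ℝ] ℝ) ⊗ₜ[ℝ] (ψ : Y →ₗ[ℝ] ℝ))

@[simp]
theorem tensorPairing_tmul (φ : StrongDual ℝ X) (ψ : StrongDual ℝ Y) (x : X) (y : Y) :
    tensorPairing φ ψ (x ⊗ₜ y) = φ x * ψ y := rfl

theorem tensorPairing_smul_left (c : ℝ) (φ : StrongDual ℝ X) (ψ : StrongDual ℝ Y) :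
    tensorPairing (c • φ) ψ = c • tensorPairing φ ψ := by
  ext x y; simp [mul_assoc]

theorem tensorPairing_smul_right (c : ℝ) (φ : StrongDual ℝ X) (ψ : StrongDual ℝ Y) :
    tensorPairing φ (c • ψ) = c • tensorPairing φ ψ := by
  ext x y; simp [mul_left_comm]

theorem TensorProduct.exists_eq_sum_fin (z : X ⊗[ℝ] Y) :
    ∃ (n : ℕ) (x : Fin n → X) (y : Fin n → Y), z = ∑ i, x i ⊗ₜ[ℝ] y i := by
  induction z using TensorProduct.induction_on with
  | zero => exact ⟨0, Fin.elim0, Fin.elim0, by simp⟩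
  | tmul x y => exact ⟨1, fun _ => x, fun _ => y, by simp⟩
  | add a b ha hb =>
    obtain ⟨n, x, y, rfl⟩ := ha
    obtain ⟨m, x', y', rfl⟩ := hb
    exact ⟨n + m, Fin.append x x', Fin.append y y', by simp [Fin.sum_univ_add]⟩

theorem bddBelow_projectiveNorm_set (z : X ⊗[ℝ] Y) :
    BddBelow {r : ℝ | ∃ (n : ℕ) (x : Fin n → X) (y : Fin n → Y),
      z = ∑ i, x i ⊗ₜ[ℝ] y i ∧ r = ∑ i, ‖x i‖ * ‖y i‖} := by
  refine ⟨0, ?_⟩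
  rintro r ⟨n, x, y, -, rfl⟩
  positivity

theorem nonempty_projectiveNorm_set (z : X ⊗[ℝ] Y) :
    {r : ℝ | ∃ (n : ℕ) (x : Fin n → X) (y : Fin n → Y),
      z = ∑ i, x i ⊗ₜ[ℝ] y i ∧ r = ∑ i, ‖x i‖ * ‖y i‖}.Nonempty := by
  obtain ⟨n, x, y, h⟩ := TensorProduct.exists_eq_sum_fin z
  exact ⟨_, n, x, y, h, rfl⟩

theorem projectiveNorm_nonneg (z : X ⊗[ℝ] Y) : 0 ≤ projectiveNorm z := by
  refine Real.sInf_nonneg ?_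
  rintro r ⟨n, x, y, -, rfl⟩
  positivity

theorem projectiveNorm_sum_tmul_le {ι : Type*} [Fintype ι] (x : ι → X) (y : ι → Y) :
    projectiveNorm (∑ i, x i ⊗ₜ[ℝ] y i) ≤ ∑ i, ‖x i‖ * ‖y i‖ := by
  refine csInf_le (bddBelow_projectiveNorm_set _) ?_
  let e := (Fintype.equivFin ι).symm
  refine ⟨_, fun k => x (e k), fun k => y (e k), ?_, ?_⟩
  · exact (e.sum_comp fun i => x i ⊗ₜ[ℝ] y i).symm
  · exact (e.sum_comp fun i => ‖x i‖ * ‖y i‖).symm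

theorem projectiveNorm_add_le (z w : X ⊗[ℝ] Y) :
    projectiveNorm (z + w) ≤ projectiveNorm z + projectiveNorm w := by
  refine le_of_forall_pos_le_add fun ε hε => ?_
  obtain ⟨_, ⟨n, x, y, hz, rfl⟩, h1⟩ :=
    Real.lt_sInf_add_pos (nonempty_projectiveNorm_set z) (half_pos hε)
  obtain ⟨_, ⟨m, x', y', hw, rfl⟩, h2⟩ :=
    Real.lt_sInf_add_pos (nonempty_projectiveNorm_set w) (half_pos hε)
  have h := projectiveNorm_sum_tmul_le (Sum.elim x x') (Sum.elim y y')
  simp only [Fintype.sum_sum_type, Sum.elim_inl, Sum.elim_inr, ← hz, ← hw] at h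
  change _ < projectiveNorm z + ε / 2 at h1
  change _ < projectiveNorm w + ε / 2 at h2
  linarith

theorem projectiveNorm_smul_le (c : ℝ) (z : X ⊗[ℝ] Y) :
    projectiveNorm (c • z) ≤ |c| * projectiveNorm z := by
  refine le_of_forall_pos_le_add fun ε hε => ?_
  obtain ⟨_, ⟨n, x, y, hz, rfl⟩, h1⟩ :=
    Real.lt_sInf_add_pos (nonempty_projectiveNorm_set z)
      (show 0 < ε / (|c| + 1) by positivity)
  have h := projectiveNorm_sum_tmul_le (fun i => c • x i) y
  simp only [← TensorProduct.smul_tmul', ← Finset.smul_sum, ← hz, norm_smul, mul_assoc,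
    ← Finset.mul_sum, Real.norm_eq_abs] at h
  refine h.trans ((mul_le_mul_of_nonneg_left h1.le (abs_nonneg c)).trans ?_)
  rw [mul_add]
  have : |c| * (ε / (|c| + 1)) ≤ ε := by
    rw [mul_div_left_comm]
    exact mul_le_of_le_one_right hε.le
      ((div_le_one (by positivity)).2 (by linarith))
  exact add_le_add le_rfl this

theorem projectiveNorm_smul (c : ℝ) (z : X ⊗[ℝ] Y) :
    projectiveNorm (c • z) = |c| * projectiveNorm z := by
  refine le_antisymm (projectiveNorm_smul_le c z) ?_
  rcases eq_or_ne c 0 with rfl | hc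
  · simpa using projectiveNorm_nonneg _
  · have h := projectiveNorm_smul_le c⁻¹ (c • z)
    rw [inv_smul_smul₀ hc, abs_inv] at h
    rwa [← le_inv_mul_iff₀ (abs_pos.2 hc)]

/-- A functional that is bounded by `‖x‖ * ‖y‖` on pure tensors is bounded by the projective
norm. -/
theorem le_projectiveNorm_of_tmul_le (L : X ⊗[ℝ] Y →ₗ[ℝ] ℝ)
    (hL : ∀ x y, L (x ⊗ₜ y) ≤ ‖x‖ * ‖y‖) (z : X ⊗[ℝ] Y) : L z ≤ projectiveNorm z := by
  refine le_csInf (nonempty_projectiveNorm_set z) ?_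
  rintro r ⟨n, x, y, rfl, rfl⟩
  rw [map_sum]
  exact Finset.sum_le_sum fun i _ => hL _ _

theorem abs_tensorPairing_le_projectiveNorm {φ : StrongDual ℝ X} {ψ : StrongDual ℝ Y}
    (hφ : ‖φ‖ ≤ 1) (hψ : ‖ψ‖ ≤ 1) (z : X ⊗[ℝ] Y) :
    |tensorPairing φ ψ z| ≤ projectiveNorm z := by
  have key : ∀ x y, |tensorPairing φ ψ (x ⊗ₜ y)| ≤ ‖x‖ * ‖y‖ := fun x y => by
    rw [tensorPairing_tmul, abs_mul]
    exact mul_le_mul (φ.le_of_opNorm_le_of_le hφ le_rfl |>.trans (one_mul _).le)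
      (ψ.le_of_opNorm_le_of_le hψ le_rfl |>.trans (one_mul _).le) (abs_nonneg _) (norm_nonneg _)
  rw [abs_le']
  refine ⟨le_projectiveNorm_of_tmul_le _ (fun x y => (le_abs_self _).trans (key x y)) z, ?_⟩
  exact le_projectiveNorm_of_tmul_le (-tensorPairing φ ψ)
    (fun x y => (neg_le_abs _).trans (key x y)) z

theorem bddAbove_injectiveNorm_set (z : X ⊗[ℝ] Y) :
    BddAbove {r : ℝ | ∃ (φ : StrongDual ℝ X) (ψ : StrongDual ℝ Y), ‖φ‖ ≤ 1 ∧ ‖ψ‖ ≤ 1 ∧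
      r = |TensorProduct.dualDistrib ℝ X Y ((φ : X →ₗ[ℝ] ℝ) ⊗ₜ[ℝ] (ψ : Y →ₗ[ℝ] ℝ)) z|} := by
  refine ⟨projectiveNorm z, ?_⟩
  rintro r ⟨φ, ψ, hφ, hψ, rfl⟩
  exact abs_tensorPairing_le_projectiveNorm hφ hψ z

theorem abs_tensorPairing_le_injectiveNorm {φ : StrongDual ℝ X} {ψ : StrongDual ℝ Y}
    (hφ : ‖φ‖ ≤ 1) (hψ : ‖ψ‖ ≤ 1) (z : X ⊗[ℝ] Y) :
    |tensorPairing φ ψ z| ≤ injectiveNorm z :=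
  le_csSup (bddAbove_injectiveNorm_set z) ⟨φ, ψ, hφ, hψ, rfl⟩

theorem injectiveNorm_le {z : X ⊗[ℝ] Y} {c : ℝ}
    (h : ∀ (φ : StrongDual ℝ X) (ψ : StrongDual ℝ Y), ‖φ‖ ≤ 1 → ‖ψ‖ ≤ 1 →
      |tensorPairing φ ψ z| ≤ c) : injectiveNorm z ≤ c := by
  refine csSup_le ⟨_, 0, 0, by simp, by simp, rfl⟩ ?_
  rintro r ⟨φ, ψ, hφ, hψ, rfl⟩
  exact h φ ψ hφ hψ

theorem injectiveNorm_nonneg (z : X ⊗[ℝ] Y) : 0 ≤ injectiveNorm z :=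
  (abs_nonneg _).trans
    (abs_tensorPairing_le_injectiveNorm (φ := 0) (ψ := 0) (by simp) (by simp) z)

theorem injectiveNorm_le_projectiveNorm (z : X ⊗[ℝ] Y) : injectiveNorm z ≤ projectiveNorm z :=
  injectiveNorm_le fun _ _ hφ hψ => abs_tensorPairing_le_projectiveNorm hφ hψ z

theorem injectiveNorm_add_le (z w : X ⊗[ℝ] Y) :
    injectiveNorm (z + w) ≤ injectiveNorm z + injectiveNorm w := by
  refine injectiveNorm_le fun φ ψ hφ hψ => ?_
  rw [map_add]
  exact (abs_add_le _ _).trans (add_le_add (abs_tensorPairing_le_injectiveNorm hφ hψ z)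
    (abs_tensorPairing_le_injectiveNorm hφ hψ w))

theorem injectiveNorm_smul_le (c : ℝ) (z : X ⊗[ℝ] Y) :
    injectiveNorm (c • z) ≤ |c| * injectiveNorm z := by
  refine injectiveNorm_le fun φ ψ hφ hψ => ?_
  rw [map_smul, smul_eq_mul, abs_mul]
  exact mul_le_mul_of_nonneg_left (abs_tensorPairing_le_injectiveNorm hφ hψ z) (abs_nonneg c)

theorem injectiveNorm_smul (c : ℝ) (z : X ⊗[ℝ] Y) :
    injectiveNorm (c • z) = |c| * injectiveNorm z := by
  refine le_antisymm (injectiveNorm_smul_le c z) ?_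
  rcases eq_or_ne c 0 with rfl | hc
  · simpa using injectiveNorm_nonneg _
  · have h := injectiveNorm_smul_le c⁻¹ (c • z)
    rw [inv_smul_smul₀ hc, abs_inv] at h
    rwa [← le_inv_mul_iff₀ (abs_pos.2 hc)]

/-- In finite dimension the functionals `φ ⊗ ψ` span the dual of the tensor product, hence separate
points. -/
theorem eq_zero_of_injectiveNorm_eq_zero [FiniteDimensional ℝ X] [FiniteDimensional ℝ Y]
    {z : X ⊗[ℝ] Y} (hz : injectiveNorm z = 0) : z = 0 := by
  have key : ∀ (φ : StrongDual ℝ X) (ψ : StrongDual ℝ Y), tensorPairing φ ψ z = 0 := by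
    intro φ ψ
    -- Dividing by `‖φ‖ + 1` instead of `‖φ‖` covers the zero functional too.
    have h := abs_tensorPairing_le_injectiveNorm (φ := (‖φ‖ + 1)⁻¹ • φ) (ψ := (‖ψ‖ + 1)⁻¹ • ψ)
      (by
        rw [norm_smul, norm_inv, Real.norm_of_nonneg (by positivity), inv_mul_le_one₀]
        · linarith
        · positivity)
      (by
        rw [norm_smul, norm_inv, Real.norm_of_nonneg (by positivity), inv_mul_le_one₀]
        · linarith
        · positivity) z
    rw [hz, tensorPairing_smul_left, tensorPairing_smul_right] at h
    have h0 := abs_nonpos_iff.1 h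
    simp only [LinearMap.smul_apply, smul_eq_mul, mul_eq_zero, inv_eq_zero] at h0
    rcases h0 with h0 | h0 | h0
    · linarith [norm_nonneg φ]
    · linarith [norm_nonneg ψ]
    · exact h0
  rw [← Module.forall_dual_apply_eq_zero_iff ℝ]
  intro θ
  obtain ⟨t, rfl⟩ := (TensorProduct.dualDistribEquiv ℝ X Y).surjective θ
  change TensorProduct.dualDistrib ℝ X Y t z = 0
  induction t using TensorProduct.induction_on with
  | zero => simp
  | tmul φ ψ =>
    exact key (LinearMap.toContinuousLinearMap φ) (LinearMap.toContinuousLinearMap ψ)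
  | add a b ha hb => simp [ha, hb]

theorem injectiveNorm_pos [FiniteDimensional ℝ X] [FiniteDimensional ℝ Y]
    {z : X ⊗[ℝ] Y} (hz : z ≠ 0) : 0 < injectiveNorm z :=
  (injectiveNorm_nonneg z).lt_of_ne fun h => hz (eq_zero_of_injectiveNorm_eq_zero h.symm)

theorem injectiveNorm_zero : injectiveNorm (0 : X ⊗[ℝ] Y) = 0 := by
  simpa using injectiveNorm_smul 0 (0 : X ⊗[ℝ] Y)

theorem projectiveNorm_zero : projectiveNorm (0 : X ⊗[ℝ] Y) = 0 := by
  simpa using projectiveNorm_smul 0 (0 : X ⊗[ℝ] Y)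

-- The projective norm is convex, hence continuous in finite dimension, and attains its maximum on
-- the compact unit sphere of the injective norm; homogeneity extends the bound to all tensors.
variable (X Y) in
theorem exists_injectiveNorm_eq_one_forall_projectiveNorm_le
    [FiniteDimensional ℝ X] [FiniteDimensional ℝ Y] [Nontrivial (X ⊗[ℝ] Y)] :
    ∃ z : X ⊗[ℝ] Y, injectiveNorm z = 1 ∧
      ∀ w : X ⊗[ℝ] Y, projectiveNorm w ≤ projectiveNorm z * injectiveNorm w := by
  let : Norm (X ⊗[ℝ] Y) := ⟨injectiveNorm⟩
  have core : NormedSpace.Core ℝ (X ⊗[ℝ] Y) :=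
    { norm_nonneg := injectiveNorm_nonneg
      norm_smul := injectiveNorm_smul
      norm_triangle := injectiveNorm_add_le
      norm_eq_zero_iff := fun z : X ⊗[ℝ] Y =>
        ⟨fun h => eq_zero_of_injectiveNorm_eq_zero (X := X) (Y := Y) h,
          fun h => (congrArg injectiveNorm h).trans injectiveNorm_zero⟩ }
  let := NormedAddCommGroup.ofCore core
  let := NormedSpace.ofCore core
  let p : Seminorm ℝ (X ⊗[ℝ] Y) :=
    Seminorm.of projectiveNorm projectiveNorm_add_le projectiveNorm_smul
  have hp : Continuous (projectiveNorm : X ⊗[ℝ] Y → ℝ) := by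
    rw [← continuousOn_univ]
    exact p.convexOn.continuousOn isOpen_univ
  have : ProperSpace (X ⊗[ℝ] Y) := FiniteDimensional.proper ℝ _
  obtain ⟨z, hz, hmax⟩ := (isCompact_sphere (0 : X ⊗[ℝ] Y) 1).exists_isMaxOn
    (NormedSpace.sphere_nonempty.2 zero_le_one) hp.continuousOn
  have hz1 : injectiveNorm z = 1 := mem_sphere_zero_iff_norm.1 hz
  refine ⟨z, hz1, fun w => ?_⟩
  rcases eq_or_ne w 0 with rfl | hw
  · simp [projectiveNorm_zero, injectiveNorm_zero]
  · have hpos := injectiveNorm_pos hw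
    have hmem : (injectiveNorm w)⁻¹ • w ∈ Metric.sphere (0 : X ⊗[ℝ] Y) 1 := by
      rw [mem_sphere_zero_iff_norm]
      change injectiveNorm _ = 1
      rw [injectiveNorm_smul, abs_of_pos (inv_pos.2 hpos), inv_mul_cancel₀ hpos.ne']
    have h : projectiveNorm ((injectiveNorm w)⁻¹ • w) ≤ projectiveNorm z := hmax hmem
    rwa [projectiveNorm_smul, abs_of_pos (inv_pos.2 hpos), inv_mul_le_iff₀ hpos, mul_comm] at h

variable (X Y) in
theorem isGreatest_maxNormRatio
    [FiniteDimensional ℝ X] [FiniteDimensional ℝ Y] [Nontrivial (X ⊗[ℝ] Y)] :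
    IsGreatest (normRatios X Y) (maxNormRatio X Y) ∧
    IsGreatest {r | ∃ z : X ⊗[ℝ] Y, injectiveNorm z ≤ 1 ∧ r = projectiveNorm z}
      (maxNormRatio X Y) ∧
    1 ≤ maxNormRatio X Y := by
  obtain ⟨z, hz, hmax⟩ := exists_injectiveNorm_eq_one_forall_projectiveNorm_le X Y
  have h1 : IsGreatest (normRatios X Y) (projectiveNorm z) := by
    refine ⟨⟨z, ?_, by rw [hz, div_one]⟩, ?_⟩
    · rintro rfl
      simp [injectiveNorm_zero] at hz
    · rintro r ⟨w, hw, rfl⟩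
      rw [div_le_iff₀ (injectiveNorm_pos hw)]
      exact hmax w
  rw [maxNormRatio, h1.csSup_eq]
  refine ⟨h1, ⟨⟨z, hz.le, rfl⟩, ?_⟩, hz ▸ injectiveNorm_le_projectiveNorm z⟩
  rintro r ⟨w, hw, rfl⟩
  exact (hmax w).trans (mul_le_of_le_one_right (projectiveNorm_nonneg z) hw)

end TensorNorms

/-! ### Coordinates and explicit norms over `ℓ_1` and `ℓ_∞` -/

section Coordinates

variable {p : ℝ≥0∞} {g : ℕ} {Y : Type*}

/-- The coordinate map `∑ᵢ eᵢ ⊗ zᵢ ↦ zᵢ`. -/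
noncomputable def tensorCoord [AddCommGroup Y] [Module ℝ Y] (i : Fin g) :
    ell p g ⊗[ℝ] Y →ₗ[ℝ] Y :=
  (TensorProduct.lid ℝ Y).toLinearMap ∘ₗ
    LinearMap.rTensor Y (PiLp.proj p (𝕜 := ℝ) (fun _ : Fin g => ℝ) i).toLinearMap

@[simp]
theorem tensorCoord_tmul [AddCommGroup Y] [Module ℝ Y] (i : Fin g) (x : ell p g) (y : Y) :
    tensorCoord i (x ⊗ₜ[ℝ] y) = x i • y := by
  simp [tensorCoord]

/-- The tensor `∑ᵢ eᵢ ⊗ zᵢ`. -/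
noncomputable def tensorOfCoords (p : ℝ≥0∞) [AddCommGroup Y] [Module ℝ Y] (z : Fin g → Y) :
    ell p g ⊗[ℝ] Y :=
  ∑ i, (WithLp.toLp p (Pi.single i (1 : ℝ)) : ell p g) ⊗ₜ[ℝ] z i

@[simp]
theorem tensorCoord_tensorOfCoords [AddCommGroup Y] [Module ℝ Y] (z : Fin g → Y) (i : Fin g) :
    tensorCoord i (tensorOfCoords p z) = z i := by
  simp [tensorOfCoords]

theorem ell_eq_sum_single (x : ell p g) :
    x = ∑ i, x i • (WithLp.toLp p (Pi.single i (1 : ℝ)) : ell p g) := by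
  ext j
  simp [Pi.single_apply]

theorem tensorOfCoords_tensorCoord [AddCommGroup Y] [Module ℝ Y] (z : ell p g ⊗[ℝ] Y) :
    tensorOfCoords p (fun i => tensorCoord i z) = z := by
  induction z using TensorProduct.induction_on with
  | zero => simp [tensorOfCoords]
  | tmul x y =>
    conv_rhs => rw [ell_eq_sum_single x]
    simp [tensorOfCoords, TensorProduct.sum_tmul, TensorProduct.smul_tmul]
  | add a b ha hb =>
    conv_rhs => rw [← ha, ← hb]
    simp [tensorOfCoords, TensorProduct.tmul_add, Finset.sum_add_distrib]

theorem tensorScale_tensorOfCoords [AddCommGroup Y] [Module ℝ Y] (s : Fin g → ℝ) (z : Fin g → Y) :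
    tensorScale p s (tensorOfCoords p z) = tensorOfCoords p (fun i => s i • z i) :=
  tensorScale_sum_single p s z

theorem tensorScale_const [AddCommGroup Y] [Module ℝ Y] (t : ℝ) (z : ell p g ⊗[ℝ] Y) :
    tensorScale p (fun _ => t) z = t • z := by
  rw [← tensorOfCoords_tensorCoord z, tensorScale_tensorOfCoords]
  simp [tensorOfCoords, Finset.smul_sum]

variable [Fact (1 ≤ p)] [NormedAddCommGroup Y] [NormedSpace ℝ Y]

theorem tensorPairing_tensorOfCoords (χ : StrongDual ℝ (ell p g)) (ψ : StrongDual ℝ Y)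
    (z : Fin g → Y) :
    tensorPairing χ ψ (tensorOfCoords p z) = χ (WithLp.toLp p fun i => ψ (z i)) := by
  conv_rhs => rw [ell_eq_sum_single (WithLp.toLp p fun i => ψ (z i))]
  simp [tensorOfCoords, mul_comm]

/-- The functional `x ↦ ∑ᵢ aᵢ xᵢ` on `ℓ_p^g`. -/
noncomputable def ellFunctional (p : ℝ≥0∞) [Fact (1 ≤ p)] (a : Fin g → ℝ) :
    StrongDual ℝ (ell p g) :=
  ∑ i, a i • PiLp.proj p (𝕜 := ℝ) (fun _ : Fin g => ℝ) i

@[simp]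
theorem ellFunctional_apply (a : Fin g → ℝ) (x : ell p g) :
    ellFunctional p a x = ∑ i, a i * x i := by
  simp [ellFunctional]

theorem norm_ellFunctional_one_le {a : Fin g → ℝ} (ha : ∀ i, |a i| ≤ 1) :
    ‖ellFunctional 1 a‖ ≤ 1 := by
  refine ContinuousLinearMap.opNorm_le_bound _ zero_le_one fun x => ?_
  rw [ellFunctional_apply, one_mul, PiLp.norm_eq_of_L1]
  refine (norm_sum_le _ _).trans (Finset.sum_le_sum fun i _ => ?_)
  rw [norm_mul]
  exact mul_le_of_le_one_left (norm_nonneg _) (ha i)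

theorem norm_sum_smul_le_injectiveNorm_one {a : Fin g → ℝ} (ha : ∀ i, |a i| ≤ 1) (z : Fin g → Y) :
    ‖∑ i, a i • z i‖ ≤ injectiveNorm (tensorOfCoords 1 z) := by
  obtain ⟨ψ, hψ, hz⟩ := exists_dual_vector'' ℝ (∑ i, a i • z i)
  have h := abs_tensorPairing_le_injectiveNorm (norm_ellFunctional_one_le ha) hψ
    (tensorOfCoords 1 z)
  rw [tensorPairing_tensorOfCoords] at h
  refine le_trans ?_ h
  refine le_trans (le_of_eq ?_) (le_abs_self _)
  rw [ellFunctional_apply]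
  simpa using hz.symm

theorem norm_coord_le_injectiveNorm_top (z : Fin g → Y) (i : Fin g) :
    ‖z i‖ ≤ injectiveNorm (tensorOfCoords ∞ z) := by
  obtain ⟨ψ, hψ, hz⟩ := exists_dual_vector'' ℝ (z i)
  have hproj : ‖PiLp.proj ∞ (𝕜 := ℝ) (fun _ : Fin g => ℝ) i‖ ≤ 1 :=
    ContinuousLinearMap.opNorm_le_bound _ zero_le_one fun x => by
      simpa using PiLp.norm_apply_le x i
  have h := abs_tensorPairing_le_injectiveNorm hproj hψ (tensorOfCoords ∞ z)
  rw [tensorPairing_tensorOfCoords] at h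
  refine le_trans ?_ h
  simp [hz]

theorem ell_top_norm_le {x : ell ∞ g} {c : ℝ} (hc : 0 ≤ c) (h : ∀ i, |x i| ≤ c) : ‖x‖ ≤ c := by
  rw [PiLp.norm_eq_ciSup]
  exact Real.iSup_le h hc

theorem injectiveNorm_top_le {z : Fin g → Y} {c : ℝ} (hc : 0 ≤ c) (hz : ∀ i, ‖z i‖ ≤ c) :
    injectiveNorm (tensorOfCoords ∞ z) ≤ c := by
  refine injectiveNorm_le fun χ ψ hχ hψ => ?_
  rw [tensorPairing_tensorOfCoords]
  refine (χ.le_of_opNorm_le_of_le hχ (ell_top_norm_le hc fun i => ?_)).trans (one_mul c).le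
  exact (ψ.le_of_opNorm_le_of_le hψ (hz i)).trans (one_mul c).le

/-- For any decomposition, apply the triangle inequality in each coordinate and exchange the two
sums; the coordinates of each `x k` add up to its `ℓ_1` norm. -/
theorem sum_norm_le_projectiveNorm_one (z : ell 1 g ⊗[ℝ] Y) :
    ∑ i, ‖tensorCoord i z‖ ≤ projectiveNorm z := by
  refine le_csInf (nonempty_projectiveNorm_set z) ?_
  rintro r ⟨n, x, y, rfl, rfl⟩
  calc ∑ i, ‖tensorCoord i (∑ k, x k ⊗ₜ[ℝ] y k)‖
      ≤ ∑ i, ∑ k, ‖x k i‖ * ‖y k‖ := Finset.sum_le_sum fun i _ => by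
        simpa [norm_smul] using norm_sum_le Finset.univ fun k => x k i • y k
    _ = ∑ k, ‖x k‖ * ‖y k‖ := by
        rw [Finset.sum_comm]
        simp only [PiLp.norm_eq_of_L1, Finset.sum_mul]

theorem projectiveNorm_one_le_sum_norm (z : Fin g → Y) :
    projectiveNorm (tensorOfCoords 1 z) ≤ ∑ i, ‖z i‖ := by
  refine (projectiveNorm_sum_tmul_le _ _).trans (Finset.sum_le_sum fun i _ => ?_)
  have : ‖(WithLp.toLp 1 (Pi.single i (1 : ℝ)) : ell 1 g)‖ ≤ 1 := by
    rw [PiLp.norm_eq_of_L1]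
    simp [Pi.single_apply, apply_ite]
  exact mul_le_of_le_one_left (norm_nonneg _) this

theorem projectiveNorm_one_eq_sum_norm (z : Fin g → Y) :
    projectiveNorm (tensorOfCoords 1 z) = ∑ i, ‖z i‖ :=
  (projectiveNorm_one_le_sum_norm z).antisymm (by
    simpa using sum_norm_le_projectiveNorm_one (tensorOfCoords 1 z))

/-- The sign `1` or `-1` of an outcome. -/
def outcomeSign (j : Fin 2) : ℝ := if j = 0 then 1 else -1

@[simp] theorem outcomeSign_zero : outcomeSign 0 = 1 := rfl

@[simp] theorem outcomeSign_one : outcomeSign 1 = -1 := rfl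

@[simp] theorem abs_outcomeSign (j : Fin 2) : |outcomeSign j| = 1 := by
  fin_cases j <;> simp

@[simp] theorem outcomeSign_rev (j : Fin 2) : outcomeSign j.rev = -outcomeSign j := by
  fin_cases j <;> simp [outcomeSign]

theorem Icc_subset_convexHull_outcomeSign :
    Set.Icc (-1 : ℝ) 1 ⊆ convexHull ℝ (Set.range outcomeSign) := by
  rw [← segment_eq_Icc (by norm_num)]
  exact segment_subset_convexHull ⟨1, rfl⟩ ⟨0, rfl⟩

/-- A norm `‖∑ᵢ aᵢ zᵢ‖` with `|aᵢ| ≤ 1` is at most its value at some choice of signs. -/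
theorem exists_norm_sum_smul_le_outcomeSign (z : Fin g → Y) {a : Fin g → ℝ} (ha : ∀ i, |a i| ≤ 1) :
    ∃ m : Fin g → Fin 2, ‖∑ i, a i • z i‖ ≤ ‖∑ i, outcomeSign (m i) • z i‖ := by
  -- The cube is the convex hull of its vertices, and a convex function on a convex hull is
  -- dominated by its value at some generating point.
  have hmem : a ∈ convexHull ℝ (Set.univ.pi fun _ : Fin g => Set.range outcomeSign) := by
    rw [convexHull_pi]
    exact fun i _ => Icc_subset_convexHull_outcomeSign (abs_le.1 (ha i))
  have hconv : ConvexOn ℝ Set.univ fun b : Fin g → ℝ => ‖∑ i, b i • z i‖ := by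
    have := (convexOn_norm (convex_univ (𝕜 := ℝ) (E := Y))).comp_linearMap
      (Fintype.linearCombination ℝ z)
    simpa [Function.comp_def, Fintype.linearCombination_apply] using this
  obtain ⟨b, hb, hle⟩ := hconv.exists_ge_of_mem_convexHull (Set.subset_univ _) hmem
  choose m hm using fun i => hb i trivial
  refine ⟨m, ?_⟩
  simpa only [hm] using hle

theorem injectiveNorm_one_le {z : Fin g → Y} {c : ℝ}
    (hz : ∀ m : Fin g → Fin 2, ‖∑ i, outcomeSign (m i) • z i‖ ≤ c) :
    injectiveNorm (tensorOfCoords 1 z) ≤ c := by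
  refine injectiveNorm_le fun χ ψ hχ hψ => ?_
  have ha : ∀ i, |χ (WithLp.toLp 1 (Pi.single i (1 : ℝ)))| ≤ 1 := fun i => by
    have h1 : ‖(WithLp.toLp 1 (Pi.single i (1 : ℝ)) : ell 1 g)‖ ≤ 1 := by
      rw [PiLp.norm_eq_of_L1]
      simp [Pi.single_apply, apply_ite]
    exact (χ.le_of_opNorm_le_of_le hχ h1).trans (one_mul 1).le
  obtain ⟨m, hm⟩ := exists_norm_sum_smul_le_outcomeSign z ha
  have heq : tensorPairing χ ψ (tensorOfCoords 1 z) =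
      ψ (∑ i, χ (WithLp.toLp 1 (Pi.single i (1 : ℝ))) • z i) := by
    simp [tensorOfCoords]
  rw [heq]
  exact (ψ.le_of_opNorm_le_of_le hψ (hm.trans (hz m))).trans (one_mul c).le

end Coordinates

/-! ### Duality between the two scaling regions and the sign decomposition -/

section Duality

variable {g : ℕ} {W : Type*} [NormedAddCommGroup W] [NormedSpace ℝ W]

/-- Norming functionals `φᵢ` of the `zᵢ` form a tensor in the injective unit ball over `ℓ_∞`.
Pairing with `z` is bounded by the projective norm there because `‖∑ xᵢ zᵢ‖ ≤ ‖x‖_∞` when `z` has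
injective norm at most one; evaluated at `s.φ` it gives `∑ sᵢ ‖zᵢ‖`. -/
theorem scalingRegion_top_dual_subset_scalingRegion_one :
    scalingRegion ∞ g (StrongDual ℝ W) ⊆ scalingRegion 1 g W := by
  rintro s ⟨hs, h⟩
  refine ⟨hs, fun z hz => ?_⟩
  obtain ⟨z, rfl⟩ : ∃ w, z = tensorOfCoords 1 w := ⟨_, (tensorOfCoords_tensorCoord z).symm⟩
  choose φ hφ hφz using fun i => exists_dual_vector'' ℝ (z i)
  have hproj := h (tensorOfCoords ∞ φ) (injectiveNorm_top_le zero_le_one hφ)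
  let L : ell ∞ g ⊗[ℝ] StrongDual ℝ W →ₗ[ℝ] ℝ :=
    ∑ i, (ContinuousLinearMap.apply ℝ ℝ (z i)).toLinearMap ∘ₗ tensorCoord i
  have hL : ∀ x y, L (x ⊗ₜ y) ≤ ‖x‖ * ‖y‖ := by
    intro x y
    have hx : L (x ⊗ₜ y) = y (∑ i, x i • z i) := by
      simp [L, LinearMap.sum_apply]
    rw [hx, mul_comm]
    refine (le_abs_self _).trans (y.le_opNorm_of_le ?_)
    rcases eq_or_ne ‖x‖ 0 with h0 | h0
    · rw [norm_eq_zero] at h0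
      simp [h0]
    · have hxpos : 0 < ‖x‖ := (norm_nonneg x).lt_of_ne' h0
      have ha : ∀ i, |‖x‖⁻¹ * x i| ≤ 1 := fun i => by
        rw [abs_mul, abs_inv, abs_norm, inv_mul_le_one₀ hxpos]
        exact PiLp.norm_apply_le x i
      have hle := (norm_sum_smul_le_injectiveNorm_one ha z).trans hz
      simp only [mul_smul] at hle
      rwa [← Finset.smul_sum, norm_smul, norm_inv, norm_norm, inv_mul_le_one₀ hxpos] at hle
  have hle := (le_projectiveNorm_of_tmul_le L hL _).trans hproj
  rw [tensorScale_tensorOfCoords] at hle ⊢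
  rw [projectiveNorm_one_eq_sum_norm]
  refine le_trans (le_of_eq ?_) hle
  simp [L, LinearMap.sum_apply, norm_smul, hφz, abs_of_nonneg (hs _).1]

theorem projectiveNorm_tensorScale_le_injectiveNorm {p : ℝ≥0∞} [Fact (1 ≤ p)]
    [FiniteDimensional ℝ W] {s : Fin g → ℝ}
    (hs : s ∈ scalingRegion p g W) (z : ell p g ⊗[ℝ] W) :
    projectiveNorm (tensorScale p s z) ≤ injectiveNorm z := by
  rcases eq_or_ne z 0 with rfl | hz
  · simp [projectiveNorm_zero, injectiveNorm_zero]
  · have hpos := injectiveNorm_pos hz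
    have h := hs.2 ((injectiveNorm z)⁻¹ • z) (by
      rw [injectiveNorm_smul, abs_of_pos (inv_pos.2 hpos), inv_mul_cancel₀ hpos.ne'])
    rwa [map_smul, projectiveNorm_smul, abs_of_pos (inv_pos.2 hpos), inv_mul_le_one₀ hpos] at h

theorem ContinuousLinearMap.exists_norm_le_one_apply_eq_norm [FiniteDimensional ℝ W]
    (ψ : StrongDual ℝ W) : ∃ w, ‖w‖ ≤ 1 ∧ ψ w = ‖ψ‖ := by
  have : ProperSpace W := FiniteDimensional.proper ℝ W
  obtain ⟨w, hw, hmax⟩ := (isCompact_closedBall (0 : W) 1).exists_isMaxOn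
    (Metric.nonempty_closedBall.2 zero_le_one) ψ.continuous.continuousOn
  rw [mem_closedBall_zero_iff] at hw
  refine ⟨w, hw, le_antisymm ((le_abs_self _).trans (ψ.unit_le_opNorm w hw)) ?_⟩
  have key : ∀ v, ‖v‖ ≤ 1 → ψ v ≤ ψ w := fun v hv => hmax (mem_closedBall_zero_iff.2 hv)
  refine ψ.opNorm_le_of_unit_norm (by simpa using key 0 (by simp)) fun v hv => ?_
  rw [Real.norm_eq_abs, abs_le']
  exact ⟨key v hv.le, by simpa using key (-v) (by simpa using hv.le)⟩

/-- Unit-ball vectors norming the components separately assemble into a single vector of the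
sup-norm unit ball. -/
theorem sum_norm_comp_single_le_norm [FiniteDimensional ℝ W] {ι : Type*} [Fintype ι]
    [DecidableEq ι] (Ψ : StrongDual ℝ (ι → W)) :
    ∑ i, ‖Ψ.comp (ContinuousLinearMap.single ℝ (fun _ : ι => W) i)‖ ≤ ‖Ψ‖ := by
  choose w hw hψ using fun i =>
    (Ψ.comp (ContinuousLinearMap.single ℝ (fun _ : ι => W) i)).exists_norm_le_one_apply_eq_norm
  have h : ∑ i, ‖Ψ.comp (ContinuousLinearMap.single ℝ (fun _ : ι => W) i)‖ = Ψ w := by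
    conv_rhs => rw [← Finset.univ_sum_single w, map_sum]
    exact Finset.sum_congr rfl fun i _ => (hψ i).symm
  rw [h]
  exact (le_abs_self _).trans (Ψ.unit_le_opNorm w ((pi_norm_le_iff_of_nonneg zero_le_one).2 hw))

/-- For `s` in the scaling region of `ℓ₁ ⊗ W`, the tensor `∑ᵢ eᵢ ⊗ sᵢ φᵢ` in the dual has a
decomposition over sign vectors of total norm at most one. -/
theorem exists_sign_decomposition [FiniteDimensional ℝ W] {s : Fin g → ℝ}
    (hs : s ∈ scalingRegion 1 g W) {φ : Fin g → StrongDual ℝ W} (hφ : ∀ i, ‖φ i‖ ≤ 1) :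
    ∃ ψ : (Fin g → Fin 2) → StrongDual ℝ W, ∑ m, ‖ψ m‖ ≤ 1 ∧
      ∀ i, s i • φ i = ∑ m, outcomeSign (m i) • ψ m := by
  -- With the sup norm on the target, `‖T z‖` bounds the injective norm over `ℓ_1`. The functional
  -- `ℓ`, pairing `z` with `s.φ`, is then bounded by `‖T z‖`, so it factors through the range of `T`
  -- and extends by Hahn–Banach; the components of the extension are the `ψ m`.
  let T : (Fin g → W) →ₗ[ℝ] ((Fin g → Fin 2) → W) :=
    LinearMap.pi fun m => ∑ i, outcomeSign (m i) • LinearMap.proj i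
  have hT : ∀ z m, T z m = ∑ i, outcomeSign (m i) • z i := fun z m => by
    simp [T, LinearMap.sum_apply]
  let ℓ : (Fin g → W) →ₗ[ℝ] ℝ := ∑ i, s i • (φ i).toLinearMap ∘ₗ LinearMap.proj i
  have hℓ : ∀ z, ℓ z = ∑ i, s i * φ i (z i) := fun z => by
    simp [ℓ, LinearMap.sum_apply]
  have hbound : ∀ z, |ℓ z| ≤ ‖T z‖ := by
    intro z
    calc |ℓ z| ≤ ∑ i, ‖s i • z i‖ := by
          rw [hℓ]
          refine (Finset.abs_sum_le_sum_abs _ _).trans (Finset.sum_le_sum fun i _ => ?_)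
          rw [abs_mul, norm_smul]
          exact mul_le_mul_of_nonneg_left
            (((φ i).le_of_opNorm_le_of_le (hφ i) le_rfl).trans (one_mul _).le) (abs_nonneg _)
      _ = projectiveNorm (tensorScale 1 s (tensorOfCoords 1 z)) := by
          rw [tensorScale_tensorOfCoords, projectiveNorm_one_eq_sum_norm]
      _ ≤ injectiveNorm (tensorOfCoords 1 z) := projectiveNorm_tensorScale_le_injectiveNorm hs _
      _ ≤ ‖T z‖ := injectiveNorm_one_le fun m => by
          rw [← hT]
          exact norm_le_pi_norm (T z) m
  obtain ⟨F, hF⟩ : ∃ F : Module.Dual ℝ ((Fin g → Fin 2) → W), T.dualMap F = ℓ := by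
    have : ℓ ∈ LinearMap.range T.dualMap := by
      rw [LinearMap.range_dualMap_eq_dualAnnihilator_ker, Submodule.mem_dualAnnihilator]
      intro z hz
      have := hbound z
      rw [LinearMap.mem_ker.1 hz, norm_zero] at this
      exact abs_nonpos_iff.1 this
    exact this
  have hFT : ∀ z, F (T z) = ℓ z := fun z => by rw [← hF]; rfl
  let f : StrongDual ℝ (LinearMap.range T) :=
    LinearMap.mkContinuous (F.domRestrict (LinearMap.range T)) 1 (by
      rintro ⟨_, z, rfl⟩
      rw [LinearMap.domRestrict_apply, one_mul, Real.norm_eq_abs]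
      change |F (T z)| ≤ ‖T z‖
      rw [hFT]
      exact hbound z)
  obtain ⟨Ψ, hΨ, hΨn⟩ := exists_extension_norm_eq (LinearMap.range T) f
  have hΨ1 : ‖Ψ‖ ≤ 1 := hΨn ▸ LinearMap.mkContinuous_norm_le _ zero_le_one _
  refine ⟨fun m => Ψ.comp (ContinuousLinearMap.single ℝ (fun _ => W) m),
    (sum_norm_comp_single_le_norm Ψ).trans hΨ1, fun i => ?_⟩
  ext w
  have h1 : Ψ (T (Pi.single i w)) = ℓ (Pi.single i w) := by
    rw [← hFT]
    exact hΨ ⟨_, Pi.single i w, rfl⟩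
  have h2 : ℓ (Pi.single i w) = s i * φ i w := by
    rw [hℓ, Finset.sum_eq_single i (fun j _ hj => by simp [hj]) (by simp)]
    simp
  have h3 : T (Pi.single i w) = ∑ m, Pi.single m (outcomeSign (m i) • w) := by
    rw [Finset.univ_sum_single fun m : Fin g → Fin 2 => outcomeSign (m i) • w]
    ext1 m
    rw [hT, Finset.sum_eq_single i (fun j _ hj => by simp [hj]) (by simp)]
    simp
  rw [h2, h3, map_sum] at h1
  simp only [smul_apply, smul_eq_mul, sum_apply, ← h1]
  refine Finset.sum_congr rfl fun m _ => ?_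
  rw [← smul_eq_mul, ← map_smul]
  rfl

end Duality

/-! ### Post-processing and marginals of joint measurements -/

/-- Classical post-processing of the outcomes of compatible measurements gives compatible
measurements. -/
theorem GPT.Compatible.postprocess {V : Type*} [AddCommGroup V] [Module ℝ V] [TopologicalSpace V]
    {G : GPT V} {g : ℕ} {k : Fin g → ℕ} {f : ∀ i, Fin (k i) → Module.Dual ℝ V}
    (hf : G.Compatible f) {P : ∀ i, Fin (k i) → Fin (k i) → ℝ} (hP : ∀ i j l, 0 ≤ P i j l)
    (hP1 : ∀ i l, ∑ j, P i j l = 1) :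
    G.Compatible fun i j => ∑ l, P i j l • f i l := by
  obtain ⟨h, ⟨hpos, hsum⟩, hmarg⟩ := hf
  refine ⟨fun n => ∑ m, (∏ i, P i (n i) (m i)) • h m, ⟨fun n => ?_, ?_⟩, fun i j => ?_⟩
  · refine Submodule.sum_mem _ fun m _ => ?_
    exact G.dualCone.smul_mem (Finset.prod_nonneg fun i _ => hP i (n i) (m i)) (hpos m)
  · rw [Finset.sum_comm, ← hsum]
    refine Finset.sum_congr rfl fun m _ => ?_
    rw [← Finset.sum_smul, ← Fintype.prod_sum fun i j => P i j (m i)]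
    simp [hP1]
  · have hcoef : ∀ m : ∀ i, Fin (k i),
        ∑ n ∈ Finset.univ.filter (fun n : ∀ i, Fin (k i) => n i = j), ∏ l, P l (n l) (m l) =
          P i j (m i) := by
      intro m
      -- Absorbing the constraint `n i = j` into the `i`-th factor makes the sum over `n` a product
      -- of sums, in which every factor other than the `i`-th is `1`.
      have hstep : ∀ n : ∀ i, Fin (k i), (if n i = j then ∏ l, P l (n l) (m l) else 0) =
          ∏ l, if h : l = i then (if n l = h ▸ j then P l (n l) (m l) else 0)
            else P l (n l) (m l) := by
        intro n
        split_ifs with hn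
        · refine Finset.prod_congr rfl fun l _ => ?_
          by_cases hl : l = i
          · subst hl; simp [hn]
          · simp [hl]
        · refine (Finset.prod_eq_zero (Finset.mem_univ i) ?_).symm
          simp [hn]
      rw [Finset.sum_filter, Finset.sum_congr rfl fun n _ => hstep n,
        ← Fintype.prod_sum fun l b => if h : l = i then
          (if b = h ▸ j then P l b (m l) else 0) else P l b (m l),
        Finset.prod_eq_single i]
      · simp
      · intro l _ hl
        simp [hl, hP1]
      · simp
    rw [Finset.sum_comm]
    simp only [← Finset.sum_smul, hcoef, hmarg, Finset.smul_sum]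
    rw [← Finset.sum_fiberwise Finset.univ (fun m : ∀ i, Fin (k i) => m i)]
    refine Finset.sum_congr rfl fun l _ => Finset.sum_congr rfl fun m hm => ?_
    rw [(Finset.mem_filter.1 hm).2]

/-- The indicator of `m i = j` equals `(1 + outcomeSign j * outcomeSign (m i)) / 2`. -/
theorem sum_filter_outcome_eq {E : Type*} [AddCommGroup E] [Module ℝ E] {g : ℕ}
    (h : (Fin g → Fin 2) → E) (i : Fin g) (j : Fin 2) :
    ∑ m ∈ Finset.univ.filter (fun m : Fin g → Fin 2 => m i = j), h m =
      (1 / 2 : ℝ) • (∑ m, h m + outcomeSign j • ∑ m, outcomeSign (m i) • h m) := by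
  rw [Finset.sum_filter, Finset.smul_sum, ← Finset.sum_add_distrib, Finset.smul_sum]
  refine Finset.sum_congr rfl fun m _ => ?_
  generalize m i = l
  fin_cases j <;> fin_cases l <;> simp <;> module

/-! ### Effects of a centrally symmetric theory and the compatibility region -/

namespace GPT.CentralSymmetry

variable {V : Type*} [AddCommGroup V] [Module ℝ V] [TopologicalSpace V]
  {W : Type*} [NormedAddCommGroup W] [NormedSpace ℝ W] {G : GPT V}

/-- The functional `(x₀, x̄) ↦ a x₀ + ψ x̄` on `V`. -/
noncomputable def effect (S : G.CentralSymmetry W) : ℝ × StrongDual ℝ W →ₗ[ℝ] Module.Dual ℝ V where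
  toFun p := (p.1 • LinearMap.fst ℝ ℝ W + p.2.toLinearMap ∘ₗ LinearMap.snd ℝ ℝ W) ∘ₗ
    S.toProd.toLinearMap
  map_add' p q := by ext x; simp; ring
  map_smul' c p := by ext x; simp; ring

@[simp]
theorem effect_apply (S : G.CentralSymmetry W) (p : ℝ × StrongDual ℝ W) (x : V) :
    S.effect p x = p.1 * (S.toProd x).1 + p.2 (S.toProd x).2 := by
  simp [effect]

theorem unit_eq_effect (S : G.CentralSymmetry W) : G.unit = S.effect (1, 0) := by
  ext x
  simp [S.unit_apply]

theorem finiteDimensional [FiniteDimensional ℝ V] (S : G.CentralSymmetry W) :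
    FiniteDimensional ℝ W :=
  Module.Finite.of_surjective (LinearMap.snd ℝ ℝ W ∘ₗ S.toProd.toLinearMap)
    (Prod.snd_surjective.comp S.toProd.surjective)

variable [FiniteDimensional ℝ W]

theorem effect_mem_dualCone_iff (S : G.CentralSymmetry W) (p : ℝ × StrongDual ℝ W) :
    S.effect p ∈ G.dualCone ↔ ‖p.2‖ ≤ p.1 := by
  rw [dualCone, PointedCone.mem_dual]
  constructor
  · intro h
    obtain ⟨w, hw, hψ⟩ := p.2.exists_norm_le_one_apply_eq_norm
    -- On this state the effect takes its least normalized value, `p.1 - ‖p.2‖`.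
    have hx : S.toProd.symm (1, -w) ∈ G.cone := by
      rw [S.mem_cone_iff]
      simpa using hw
    have := h hx
    simp [hψ] at this
    exact this
  · intro h x hx
    have hx' := (S.mem_cone_iff x).1 hx
    have h1 := (abs_le.1 (p.2.le_opNorm (S.toProd x).2)).1
    have h2 := mul_le_mul h hx' (norm_nonneg _) ((norm_nonneg _).trans h)
    rw [Module.Dual.eval_apply, effect_apply]
    linarith

/-- The coordinates of a functional on `V`. -/
noncomputable def dualCoord (S : G.CentralSymmetry W) :
    Module.Dual ℝ V →ₗ[ℝ] ℝ × StrongDual ℝ W :=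
  (Module.Dual.eval ℝ V (S.toProd.symm (1, 0))).prod
    (LinearMap.toContinuousLinearMap.toLinearMap ∘ₗ
      LinearMap.dualMap (S.toProd.symm.toLinearMap ∘ₗ LinearMap.inr ℝ ℝ W))

@[simp]
theorem effect_dualCoord (S : G.CentralSymmetry W) (f : Module.Dual ℝ V) :
    S.effect (S.dualCoord f) = f := by
  ext x
  obtain ⟨⟨a, w⟩, rfl⟩ := S.toProd.symm.surjective x
  have h : S.toProd.symm (a, w) = a • S.toProd.symm (1, 0) + S.toProd.symm (0, w) := by
    rw [← map_smul, ← map_add]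
    simp
  rw [effect_apply, h]
  simp [dualCoord, mul_comm]

@[simp]
theorem dualCoord_effect (S : G.CentralSymmetry W) (p : ℝ × StrongDual ℝ W) :
    S.dualCoord (S.effect p) = p := by
  ext <;> simp [dualCoord]

theorem mem_dualCone_iff (S : G.CentralSymmetry W) (f : Module.Dual ℝ V) :
    f ∈ G.dualCone ↔ ‖(S.dualCoord f).2‖ ≤ (S.dualCoord f).1 := by
  rw [← S.effect_mem_dualCone_iff, effect_dualCoord]

theorem dualCoord_unit (S : G.CentralSymmetry W) : S.dualCoord G.unit = (1, 0) := by
  rw [S.unit_eq_effect, dualCoord_effect]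

variable {g : ℕ}

/-- Signed sums of the joint effects isolate the vector parts of the marginals, giving a
decomposition of `s.φ` over sign vectors. Its cost is at most the sum of the scalar parts of the
joint effects, which is `1` by normalization. -/
theorem compatibilityRegion_subset_scalingRegion (S : G.CentralSymmetry W) :
    G.compatibilityRegion (dichotomic g) ⊆ scalingRegion ∞ g (StrongDual ℝ W) := by
  rintro s ⟨hs, hcomp⟩
  refine ⟨hs, fun z hz => ?_⟩
  obtain ⟨φ, rfl⟩ : ∃ φ, z = tensorOfCoords ∞ φ := ⟨_, (tensorOfCoords_tensorCoord z).symm⟩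
  have hφ : ∀ i, ‖φ i‖ ≤ 1 := fun i => (norm_coord_le_injectiveNorm_top φ i).trans hz
  obtain ⟨h, ⟨hpos, hsum⟩, hmarg⟩ := hcomp
    (fun i j => S.effect (1 / 2, (outcomeSign j / 2) • φ i)) (by
      intro i
      refine ⟨fun j => ?_, ?_⟩
      · rw [S.effect_mem_dualCone_iff, norm_smul, Real.norm_eq_abs, abs_div, abs_outcomeSign]
        have := hφ i
        norm_num
        linarith
      · rw [Fin.sum_univ_two, ← map_add, S.unit_eq_effect]
        congr 1
        ext1
        · norm_num
        · simp only [outcomeSign_zero, outcomeSign_one, Prod.snd_add]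
          module)
  have hvec : ∀ i, s i • φ i = ∑ m, outcomeSign (m i) • (S.dualCoord (h m)).2 := by
    intro i
    have h0 := (hmarg i 0).symm
    erw [sum_filter_outcome_eq h i 0] at h0
    rw [hsum, noisy] at h0
    have h1 := congrArg (fun f => (2 : ℝ) • (S.dualCoord f).2) h0
    simp only [map_smul, map_add, map_sum, dualCoord_effect, dualCoord_unit, Prod.smul_snd,
      Prod.snd_add, Prod.snd_sum, outcomeSign_zero, one_smul, smul_zero, zero_add,
      add_zero, smul_smul] at h1
    norm_num at h1
    rw [h1]
    congr 1
    ring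
  have htensor : tensorScale ∞ s (tensorOfCoords ∞ φ) =
      ∑ m : Fin g → Fin 2, (WithLp.toLp ∞ fun i => outcomeSign (m i) : ell ∞ g) ⊗ₜ[ℝ]
        (S.dualCoord (h m)).2 := by
    rw [tensorScale_tensorOfCoords]
    simp only [hvec, tensorOfCoords, TensorProduct.tmul_sum]
    rw [Finset.sum_comm]
    refine Finset.sum_congr rfl fun m _ => ?_
    rw [ell_eq_sum_single (WithLp.toLp ∞ fun i => outcomeSign (m i))]
    simp [TensorProduct.sum_tmul, TensorProduct.smul_tmul]
  rw [htensor]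
  refine (projectiveNorm_sum_tmul_le _ _).trans ?_
  have hone : ∑ m, (S.dualCoord (h m)).1 = 1 := by
    have := congrArg (fun f => (S.dualCoord f).1) hsum
    simpa [map_sum, Prod.fst_sum, dualCoord_unit] using this
  rw [← hone]
  refine Finset.sum_le_sum fun m _ => ?_
  refine (mul_le_of_le_one_left (norm_nonneg _) ?_).trans ((S.mem_dualCone_iff _).1 (hpos m))
  exact ell_top_norm_le zero_le_one fun i => (abs_outcomeSign _).le

theorem compatible_of_sign_decomposition (S : G.CentralSymmetry W)
    {φ : Fin g → StrongDual ℝ W} {ψ : (Fin g → Fin 2) → StrongDual ℝ W}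
    (hψ : ∑ m, ‖ψ m‖ ≤ 1) (hφ : ∀ i, φ i = ∑ m, outcomeSign (m i) • ψ m) :
    G.Compatible (k := dichotomic g) fun i j =>
      S.effect (1 / 2, (outcomeSign j / 2) • φ i) := by
  -- Flipping all outcomes: antisymmetrizing `ψ` under `r` makes the vector parts sum to zero while
  -- keeping the signed sums, and symmetrizing the scalar parts makes their signed sums vanish. The
  -- constant `c` spreads the missing mass `1 - ∑ ‖ψ m‖` uniformly.
  let r : (Fin g → Fin 2) ≃ (Fin g → Fin 2) := Equiv.piCongrRight fun _ => Fin.revPerm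
  have hr : ∀ m i, outcomeSign (r m i) = -outcomeSign (m i) := fun m i => outcomeSign_rev _
  let c : ℝ := (1 - ∑ m, ‖ψ m‖) / Fintype.card (Fin g → Fin 2)
  have hc : 0 ≤ c := div_nonneg (by linarith) (Nat.cast_nonneg _)
  have hcsum : ∑ _m : Fin g → Fin 2, c = 1 - ∑ m, ‖ψ m‖ := by
    rw [Finset.sum_const, nsmul_eq_mul, Finset.card_univ]
    exact mul_div_cancel₀ _ (Nat.cast_ne_zero.2 Fintype.card_ne_zero)
  let p : (Fin g → Fin 2) → ℝ × StrongDual ℝ W := fun m =>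
    ((‖ψ m‖ + ‖ψ (r m)‖) / 2 + c, (1 / 2 : ℝ) • (ψ m - ψ (r m)))
  have hsum : ∑ m, p m = (1, 0) := by
    ext1
    · simp only [p, Prod.fst_sum, Finset.sum_add_distrib, ← Finset.sum_div,
        r.sum_comp fun m => ‖ψ m‖, hcsum]
      ring
    · simp only [p, Prod.snd_sum, ← Finset.smul_sum, Finset.sum_sub_distrib, r.sum_comp ψ,
        sub_self, smul_zero]
  have hsign : ∀ i, ∑ m, outcomeSign (m i) • p m = (0, φ i) := by
    intro i
    ext1
    · have h1 : ∑ m, outcomeSign (m i) • (p m).1 = -∑ m, outcomeSign (m i) • (p m).1 := by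
        rw [← Finset.sum_neg_distrib]
        refine (r.sum_comp _).symm.trans (Finset.sum_congr rfl fun m _ => ?_)
        have hrr : r (r m) = m := by ext i; simp [r]
        simp only [p, hr, hrr, add_comm ‖ψ (r m)‖, smul_eq_mul, neg_mul]
      simp only [Prod.fst_sum, Prod.smul_fst]
      linarith
    · have h1 : ∑ m, outcomeSign (m i) • ψ (r m) = -φ i := by
        rw [hφ, ← r.sum_comp fun m => outcomeSign (m i) • ψ m, ← Finset.sum_neg_distrib]
        refine Finset.sum_congr rfl fun m _ => ?_
        rw [hr]
        module
      simp only [p, Prod.snd_sum, Prod.smul_snd, smul_comm _ (1 / 2 : ℝ), ← Finset.smul_sum,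
        smul_sub, Finset.sum_sub_distrib, h1, ← hφ]
      module
  refine ⟨fun m => S.effect (p m), ⟨fun m => ?_, ?_⟩, fun i j => ?_⟩
  · rw [S.effect_mem_dualCone_iff, norm_smul]
    have := norm_sub_le (ψ m) (ψ (r m))
    norm_num [p]
    linarith
  · rw [← map_sum, S.unit_eq_effect]
    exact congrArg S.effect hsum
  · refine Eq.trans ?_ (sum_filter_outcome_eq (fun m => S.effect (p m)) i j).symm
    simp only [← map_smul, ← map_sum, hsum, hsign]
    rw [← map_add, ← map_smul]
    congr 1
    ext1
    · simp
    · simp only [Prod.smul_snd, Prod.snd_add, zero_add, smul_smul]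
      congr 1
      ring

/-- A biased measurement with first effect `(a, φ)` comes from the unbiased one with vector `2φ/t`,
where `t = 2 min(a, 1 - a)`: keep the outcome with weight `t`, otherwise draw a fresh one
independent of it. The noisy versions are related in the same way, so the sign decomposition for
unbiased measurements suffices. -/
theorem scalingRegion_subset_compatibilityRegion (S : G.CentralSymmetry W) :
    scalingRegion 1 g W ⊆ G.compatibilityRegion (dichotomic g) := by
  intro s hs
  refine ⟨hs.1, fun f hf => ?_⟩
  have hpos : ∀ i j, ‖(S.dualCoord (f i j)).2‖ ≤ (S.dualCoord (f i j)).1 :=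
    fun i j => (S.mem_dualCone_iff _).1 ((hf i).1 j)
  let a : Fin g → ℝ := fun i => (S.dualCoord (f i 0)).1
  let φ : Fin g → StrongDual ℝ W := fun i => (S.dualCoord (f i 0)).2
  have hf0 : ∀ i, f i 0 = S.effect (a i, φ i) := fun i => (S.effect_dualCoord _).symm
  have hf1 : ∀ i, f i 1 = S.effect (1 - a i, -φ i) := by
    intro i
    have h := (hf i).2
    erw [Fin.sum_univ_two] at h
    rw [← eq_sub_iff_add_eq', hf0, S.unit_eq_effect, ← map_sub] at h
    rw [h]
    simp
  have ha0 : ∀ i, ‖φ i‖ ≤ a i := fun i => hpos i 0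
  have ha1 : ∀ i, ‖φ i‖ ≤ 1 - a i := fun i => by
    have := hpos i 1
    rwa [hf1, dualCoord_effect, norm_neg] at this
  let t : Fin g → ℝ := fun i => 2 * min (a i) (1 - a i)
  have ht : ∀ i, 2 * ‖φ i‖ ≤ t i := fun i =>
    mul_le_mul_of_nonneg_left (le_min (ha0 i) (ha1 i)) zero_le_two
  have ht0 : ∀ i, 0 ≤ t i := fun i => le_trans (by positivity) (ht i)
  have hta : ∀ i, t i ≤ 2 * a i := fun i =>
    mul_le_mul_of_nonneg_left (min_le_left _ _) zero_le_two
  have hta1 : ∀ i, t i ≤ 2 * (1 - a i) := fun i =>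
    mul_le_mul_of_nonneg_left (min_le_right _ _) zero_le_two
  obtain ⟨φ', hφ', hφφ'⟩ : ∃ φ' : Fin g → StrongDual ℝ W, (∀ i, ‖φ' i‖ ≤ 1) ∧
      ∀ i, t i • φ' i = (2 : ℝ) • φ i := by
    -- If `t i = 0`, the inverse is `0` by convention, which is harmless since `2‖φ i‖ ≤ t i` forces
    -- `φ i = 0`.
    refine ⟨fun i => (t i)⁻¹ • (2 : ℝ) • φ i, fun i => ?_, fun i => ?_⟩
    · rw [norm_smul, norm_smul, norm_inv, Real.norm_of_nonneg (ht0 i),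
        Real.norm_of_nonneg zero_le_two]
      exact inv_mul_le_one_of_le₀ (ht i) (ht0 i)
    · rcases eq_or_ne (t i) 0 with h0 | h0
      · have : φ i = 0 := by
          rw [← norm_le_zero_iff]
          linarith [ht i]
        simp [this]
      · rw [smul_inv_smul₀ h0]
  obtain ⟨ψ, hψ, hdec⟩ := exists_sign_decomposition hs hφ'
  have hcomp := S.compatible_of_sign_decomposition hψ hdec
  -- The weight of the fresh outcome `j`, of total `1 - t i`, fixed by requiring that `t i / 2 + R i
  -- j` be the scalar part of the noisy biased effect.
  let R : Fin g → Fin 2 → ℝ := fun i j =>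
    1 / 2 + outcomeSign j * (s i * (a i - 1 / 2)) - t i / 2
  have hR : ∀ i j, 0 ≤ R i j := by
    intro i j
    have h1 := (hs.1 i).1
    have h2 := (hs.1 i).2
    have h3 := hta i
    have h4 := hta1 i
    have h5 := ht0 i
    have habs : |a i - 1 / 2| ≤ 1 / 2 - t i / 2 := abs_le.2 ⟨by linarith, by linarith⟩
    have habs2 : |outcomeSign j * (s i * (a i - 1 / 2))| ≤ 1 / 2 - t i / 2 := by
      rw [abs_mul, abs_outcomeSign, one_mul, abs_mul, abs_of_nonneg h1]
      exact (mul_le_of_le_one_left (abs_nonneg _) h2).trans habs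
    have := (abs_le.1 habs2).1
    simp only [R]
    linarith
  have hpost := hcomp.postprocess
    (P := fun i (j l : Fin 2) => (if j = l then t i else 0) + R i j)
    (fun i j l => add_nonneg (by split_ifs; exacts [ht0 i, le_rfl]) (hR i j))
    (fun i l => by
      refine (Finset.sum_add_distrib).trans ?_
      have hR2 : ∑ j : Fin 2, R i j = 1 - t i := by
        simp only [Fin.sum_univ_two, R, outcomeSign_zero, outcomeSign_one]
        ring
      refine (congrArg₂ (· + ·) ?_ hR2).trans (add_sub_cancel (t i) 1)
      exact (Finset.sum_ite_eq' Finset.univ l fun _ => t i).trans (by simp))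
  have hfj : ∀ i (j : Fin 2), f i j =
      S.effect (1 / 2 + outcomeSign j * (a i - 1 / 2), outcomeSign j • φ i) := by
    intro i j
    fin_cases j
    · refine (hf0 i).trans (congrArg S.effect ?_)
      ext1 <;> simp
    · refine (hf1 i).trans (congrArg S.effect ?_)
      ext1
      · simp
        ring
      · exact (neg_one_smul ℝ (φ i)).symm
  convert hpost using 1
  funext i
  refine funext fun j : Fin 2 => ?_
  refine Eq.trans ?_ (Fin.sum_univ_two _).symm
  rw [noisy, hfj, S.unit_eq_effect]
  simp only [← map_smul, ← map_add]
  congr 1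
  ext1
  · fin_cases j <;> simp [R] <;> ring
  · have h2 : s i • φ i = (t i * s i / 2) • φ' i := by
      have h3 : φ i = (1 / 2 : ℝ) • t i • φ' i := by rw [hφφ']; module
      rw [h3]
      module
    have h4 : s i • outcomeSign j • φ i = outcomeSign j • (t i * s i / 2) • φ' i := by
      rw [smul_comm, h2]
    simp only [Prod.snd_add, Prod.smul_snd, smul_zero, add_zero, h4]
    fin_cases j <;> simp <;> module

end GPT.CentralSymmetry

/-! ### The compatibility degree as a reciprocal norm ratio -/

theorem nontrivial_ell_tensorProduct (p : ℝ≥0∞) {g : ℕ} (hg : 0 < g) (Y : Type*) [AddCommGroup Y]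
    [Module ℝ Y] [Nontrivial Y] : Nontrivial (ell p g ⊗[ℝ] Y) := by
  obtain ⟨y, hy⟩ := exists_ne (0 : Y)
  refine nontrivial_of_ne (tensorOfCoords p fun _ : Fin g => y) 0 fun h => hy ?_
  simpa using congrArg (tensorCoord ⟨0, hg⟩) h

namespace GPT

variable {V : Type*} [AddCommGroup V] [Module ℝ V] [TopologicalSpace V] {G : GPT V} {g : ℕ}
  {k : Fin g → ℕ} {p : ℝ≥0∞} [Fact (1 ≤ p)] {Y : Type*} [NormedAddCommGroup Y] [NormedSpace ℝ Y]

theorem mem_diagonalRegion_iff (h : G.compatibilityRegion k = scalingRegion p g Y) (t : ℝ) :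
    t ∈ G.diagonalRegion k ↔ t ∈ Set.Icc (0 : ℝ) 1 ∧
      ∀ z : ell p g ⊗[ℝ] Y, injectiveNorm z ≤ 1 → t * projectiveNorm z ≤ 1 := by
  rw [diagonalRegion, h]
  simp only [scalingRegion, Set.mem_ofPred_eq, tensorScale_const, projectiveNorm_smul]
  refine and_congr_right fun ht => ?_
  rw [abs_of_nonneg ht.1]
  exact and_iff_right fun _ => ht

/-- The diagonal region is cut out of `[0,1]` by closed conditions, one for each tensor in the
injective unit ball, and contains `0`. -/
theorem isGreatest_compatibilityDegree (h : G.compatibilityRegion k = scalingRegion p g Y) :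
    IsGreatest (G.diagonalRegion k) (G.compatibilityDegree k) := by
  have heq : G.diagonalRegion k = Set.Icc (0 : ℝ) 1 ∩
      ⋂ z : {z : ell p g ⊗[ℝ] Y // injectiveNorm z ≤ 1}, {t | t * projectiveNorm z.1 ≤ 1} := by
    ext t
    rw [mem_diagonalRegion_iff h]
    simp
  have hcompact : IsCompact (G.diagonalRegion k) := by
    rw [heq]
    exact isCompact_Icc.inter_right (isClosed_iInter fun z =>
      isClosed_le (continuous_id.mul continuous_const) continuous_const)
  refine hcompact.isGreatest_sSup ⟨0, ?_⟩
  rw [mem_diagonalRegion_iff h]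
  simp

theorem compatibilityDegree_eq_one_div_maxNormRatio [FiniteDimensional ℝ Y]
    [Nontrivial (ell p g ⊗[ℝ] Y)] (h : G.compatibilityRegion k = scalingRegion p g Y) :
    G.compatibilityDegree k = 1 / maxNormRatio (ell p g) Y := by
  obtain ⟨-, ⟨⟨z, hz, hzmax⟩, hmax⟩, hone⟩ := isGreatest_maxNormRatio (ell p g) Y
  have hpos : 0 < maxNormRatio (ell p g) Y := zero_lt_one.trans_le hone
  refine IsGreatest.csSup_eq ⟨?_, fun t ht => ?_⟩
  · rw [mem_diagonalRegion_iff h]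
    -- The ratio is at least `1` because the injective norm is dominated by the projective one, so
    -- its reciprocal lies in `[0,1]`.
    refine ⟨⟨by positivity, (div_le_one hpos).2 hone⟩, fun w hw => ?_⟩
    rw [one_div, inv_mul_le_one₀ hpos]
    exact hmax ⟨w, hw, rfl⟩
  · rw [mem_diagonalRegion_iff h] at ht
    rw [le_div_iff₀ hpos, hzmax]
    exact ht.2 z hz

end GPT

theorem mainTheorem4 {V : Type*} [AddCommGroup V] [Module ℝ V] [FiniteDimensional ℝ V]
    [TopologicalSpace V] [IsTopologicalAddGroup V] [ContinuousSMul ℝ V] [T2Space V]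
    {W : Type*} [NormedAddCommGroup W] [NormedSpace ℝ W]
    (G : GPT V) (S : G.CentralSymmetry W) (g : ℕ) :
    G.compatibilityRegion (GPT.dichotomic g) = scalingRegion 1 g W ∧
    G.compatibilityRegion (GPT.dichotomic g) = scalingRegion ∞ g (StrongDual ℝ W) ∧
    IsGreatest (G.diagonalRegion (GPT.dichotomic g))
      (G.compatibilityDegree (GPT.dichotomic g)) ∧
    (0 < g → Nontrivial W →
      IsGreatest (normRatios (ell ∞ g) (StrongDual ℝ W))
        (maxNormRatio (ell ∞ g) (StrongDual ℝ W)) ∧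
      IsGreatest {r | ∃ z : ell ∞ g ⊗[ℝ] StrongDual ℝ W,
          injectiveNorm z ≤ 1 ∧ r = projectiveNorm z}
        (maxNormRatio (ell ∞ g) (StrongDual ℝ W)) ∧
      IsGreatest (normRatios (ell 1 g) W) (maxNormRatio (ell 1 g) W) ∧
      IsGreatest {r | ∃ z : ell 1 g ⊗[ℝ] W, injectiveNorm z ≤ 1 ∧ r = projectiveNorm z}
        (maxNormRatio (ell 1 g) W) ∧
      G.compatibilityDegree (GPT.dichotomic g) =
        1 / maxNormRatio (ell ∞ g) (StrongDual ℝ W) ∧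
      G.compatibilityDegree (GPT.dichotomic g) = 1 / maxNormRatio (ell 1 g) W) := by
  have := S.finiteDimensional
  have htop : G.compatibilityRegion (GPT.dichotomic g) ⊆ scalingRegion ∞ g (StrongDual ℝ W) :=
    S.compatibilityRegion_subset_scalingRegion
  have hdual : scalingRegion ∞ g (StrongDual ℝ W) ⊆ scalingRegion 1 g W :=
    scalingRegion_top_dual_subset_scalingRegion_one
  have hone : scalingRegion 1 g W ⊆ G.compatibilityRegion (GPT.dichotomic g) :=
    S.scalingRegion_subset_compatibilityRegion
  have h1 : G.compatibilityRegion (GPT.dichotomic g) = scalingRegion 1 g W :=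
    (htop.trans hdual).antisymm hone
  have h2 : G.compatibilityRegion (GPT.dichotomic g) = scalingRegion ∞ g (StrongDual ℝ W) :=
    htop.antisymm (hdual.trans hone)
  refine ⟨h1, h2, GPT.isGreatest_compatibilityDegree h1, fun hg hW => ?_⟩
  have hW' : Nontrivial (StrongDual ℝ W) := by
    obtain ⟨w, hw⟩ := exists_ne (0 : W)
    obtain ⟨ψ, -, hψ⟩ := exists_dual_vector ℝ w (norm_ne_zero_iff.2 hw)
    refine nontrivial_of_ne ψ 0 fun h => hw ?_
    simpa [h, eq_comm] using hψ
  have := nontrivial_ell_tensorProduct 1 hg W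
  have := nontrivial_ell_tensorProduct ∞ hg (StrongDual ℝ W)
  obtain ⟨hr1, hp1, -⟩ := isGreatest_maxNormRatio (ell 1 g) W
  obtain ⟨hr2, hp2, -⟩ := isGreatest_maxNormRatio (ell ∞ g) (StrongDual ℝ W)
  exact ⟨hr2, hp2, hr1, hp1, GPT.compatibilityDegree_eq_one_div_maxNormRatio h2,
    GPT.compatibilityDegree_eq_one_div_maxNormRatio h1⟩
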